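/- Let $R$ be a commutative artinian ring. All modules are $R$-modules, and a module is called indecomposable if it is nonzero and is not the direct sum of two nonzero submodules. For a finite length module $M$ and a simple module $S$, let $m_S(M)$ denote the multiplicity of $S$ as a composition factor of $M$, i.e. the number of factors isomorphic to $S$ in a composition series of $M$. Then the following are equivalent: (a) $R$ is serial, i.e. $R$ is isomorphic to a finite product of commutative artinian uniserial rings (rings whose ideals are totally ordered by inclusion); (b) $R$ is a principal ideal ring, i.e. every ideal of $R$ is principal; (c) for every proper ideal $I \subsetneq R$ (including $I = 0$), the ring $R/I$ is self-injective, i.e. injective as a module over itself; (d) $R$ has finite representation type, i.e. up to isomorphism there are only finitely many finitely generated indecomposable $R$-modules; (e) $R$ satisfies $\mathfrak{X}$: if $M$ and $N$ are finite length indecomposable $R$-modules with $m_S(M) = m_S(N)$ for every simple $R$-module $S$, then $M \cong N$. -/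

import Mathlib

universe u

namespace CompFactors

section Modules

variable (R : Type*) [CommRing R] (M : Type*) [AddCommGroup M] [Module R M]

/-- A module is indecomposable if it is nonzero and in every decomposition `M = N ⊕ P` into
submodules one of the summands is zero. -/
def IsIndecomposable : Prop :=
  Nontrivial M ∧ ∀ N P : Submodule R M, IsCompl N P → N = ⊥ ∨ P = ⊥

/-- A module is uniserial if its submodules are totally ordered by inclusion. -/
def IsUniserial : Prop :=
  ∀ N P : Submodule R M, N ≤ P ∨ P ≤ N

variable {R M}

/-- `s` is a composition series of the whole module: it runs from `0` to `M`. -/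
def IsFullSeries (s : CompositionSeries (Submodule R M)) : Prop :=
  s.head = ⊥ ∧ s.last = ⊤

/-- The number of indices `i` such that the factor `s (i + 1) / s i` of the composition
series `s` is isomorphic to `S`. -/
noncomputable def factorCount (s : CompositionSeries (Submodule R M))
    (S : Type*) [AddCommGroup S] [Module R S] : ℕ :=
  Nat.card {i : Fin s.length //
    Nonempty (S ≃ₗ[R] (s i.succ ⧸ (s i.castSucc).submoduleOf (s i.succ)))}

variable (R M) in
open Classical in
/-- The multiplicity of `S` as a composition factor of `M`: the number of factors isomorphic to
`S` in a composition series of `M` (and `0` if `M` has no composition series). It does not depend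
on the series, see `multiplicity_eq_factorCount`. -/
noncomputable def multiplicity (S : Type*) [AddCommGroup S] [Module R S] : ℕ :=
  if h : ∃ s : CompositionSeries (Submodule R M), IsFullSeries s then
    factorCount h.choose S
  else 0

theorem factorCount_eq_of_isFullSeries {s t : CompositionSeries (Submodule R M)}
    (hs : IsFullSeries s) (ht : IsFullSeries t) (S : Type*) [AddCommGroup S] [Module R S] :
    factorCount s S = factorCount t S := by
  obtain ⟨f, hf⟩ := CompositionSeries.jordan_holder s t (hs.1.trans ht.1.symm)
    (hs.2.trans ht.2.symm)
  refine Nat.card_congr (f.subtypeEquiv fun i => ?_)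
  have e := (hf i).linearEquiv
  exact ⟨fun ⟨g⟩ => ⟨g.trans e⟩, fun ⟨g⟩ => ⟨g.trans e.symm⟩⟩

theorem multiplicity_eq_factorCount {s : CompositionSeries (Submodule R M)}
    (hs : IsFullSeries s) (S : Type*) [AddCommGroup S] [Module R S] :
    multiplicity R M S = factorCount s S := by
  have h : ∃ s : CompositionSeries (Submodule R M), IsFullSeries s := ⟨s, hs⟩
  rw [multiplicity, dif_pos h]
  exact factorCount_eq_of_isFullSeries h.choose_spec hs S

end Modules

/-- A commutative artinian serial ring: a ring isomorphic to a finite product of commutative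
artinian uniserial rings. -/
def IsSerialRing (R : Type u) [CommRing R] : Prop :=
  ∃ (n : ℕ) (A : Fin n → Type u) (_ : ∀ i, CommRing (A i)),
    (∀ i, IsArtinianRing (A i) ∧ IsUniserial (A i) (A i)) ∧ Nonempty (R ≃+* ∀ i, A i)

/-- A ring is self-injective if it is injective as a module over itself. -/
def IsSelfInjective (R : Type u) [CommRing R] : Prop :=
  Module.Injective R R

/-- Finite representation type: up to isomorphism there are only finitely many finitely generated
indecomposable modules. Every finitely generated module is isomorphic to one in `Type u`, so
modules in the universe of `R` suffice. -/
def HasFiniteRepresentationType (R : Type u) [CommRing R] : Prop :=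
  ∃ (n : ℕ) (L : Fin n → ModuleCat.{u} R),
    ∀ (M : Type u) [AddCommGroup M] [Module R M],
      Module.Finite R M → IsIndecomposable R M → ∃ i, Nonempty (M ≃ₗ[R] L i)

/-- The property `𝔛`: any two finite length indecomposable modules in which every simple module
has the same multiplicity as a composition factor are isomorphic. -/
def DeterminedByCompositionFactors (R : Type u) [CommRing R] : Prop :=
  ∀ (M N : Type u) [AddCommGroup M] [Module R M] [AddCommGroup N] [Module R N],
    IsFiniteLength R M → IsFiniteLength R N →
    IsIndecomposable R M → IsIndecomposable R N →
    (∀ (S : Type u) [AddCommGroup S] [Module R S], IsSimpleModule R S →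
      multiplicity R M S = multiplicity R N S) →
    Nonempty (M ≃ₗ[R] N)

end CompFactors

/-!
Every property is shown to be equivalent to `R` being a principal ideal ring. A serial artinian ring
is one because two elements of a uniserial ring generate a principal ideal.

If `R` is a principal ideal ring, so are its localizations at maximal ideals, of which `R` is the
product. In a local artinian ring whose maximal ideal `m` is principal the ideals are the powers of
`m` (`eq_pow_of_pow_le`), so `R` is serial. In a serial artinian ring `ann a ≤ ann b` implies
`a ∣ b` (`IsSerialRing.dvd_of_annihilator_le`), which for a principal ideal ring is Baer's
criterion; hence `R` and all its quotients are self-injective. An indecomposable module `M` is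
killed by a power of one maximal ideal `m`, so the annihilators of its elements form a chain of
powers of `m`, and some `v` has the same annihilator as `M`. As `R ⧸ ann M` is self-injective, the
submodule generated by `v` is a direct summand, thus all of `M`, and `M ≅ R ⧸ m ^ i`
(`IsIndecomposable.exists_linearEquiv_quotient_pow`). There are finitely many such modules. All
composition factors of `R ⧸ m ^ i` are isomorphic to `R ⧸ m`, so they determine `m` and the length
of the module, and with these its isomorphism class.

If `R` is not a principal ideal ring, some maximal ideal `m` is not principal, and then there are
`x, y ∈ m` that are linearly independent in `m / m ^ 2` (`exists_independent_pair`). Such a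
pair refutes each of the three remaining properties:
* in `R ⧸ m ^ 2` the elements `x` and `y` have the same annihilator, but `x` does not divide `y`, so
  this ring is not self-injective;
* `R ⧸ (x, m ^ 2)` and `R ⧸ (y, m ^ 2)` are not isomorphic, although they are indecomposable of the
  same length with all composition factors isomorphic to `R ⧸ m`;
* the modules `R[X] / (X ^ n, x + y X, m ^ 2)` for `n > 0` are indecomposable and pairwise not
  isomorphic (`isIndecomposable_kroneckerModule`, `kroneckerModule_eq_of_linearEquiv`), so the
  representation type is infinite.
-/

namespace CompFactors

/-! ### Maximal ideals of artinian rings -/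

section Ideals

variable {R : Type*} [CommRing R]

theorem exists_mul_sub_one_mem {m : Ideal R} (hm : m.IsMaximal) {a : R} (ha : a ∉ m) (k : ℕ) :
    ∃ c, a * c - 1 ∈ m ^ k := by
  have h : Ideal.span {a} ⊔ m ^ k = ⊤ := by
    rw [← Ideal.isCoprime_iff_sup_eq]
    refine IsCoprime.pow_right ?_
    rw [Ideal.isCoprime_iff_sup_eq, sup_comm]
    exact hm.1.2 _ (lt_of_le_of_ne le_sup_left fun h => ha (h ▸
      (le_sup_right : Ideal.span {a} ≤ _) (Ideal.mem_span_singleton_self a)))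
  obtain ⟨u, hu, v, hv, huv⟩ := Submodule.mem_sup.1 (h ▸ Submodule.mem_top : (1 : R) ∈ _)
  obtain ⟨c, rfl⟩ := Ideal.mem_span_singleton'.1 hu
  refine ⟨c, ?_⟩
  have : a * c - 1 = -v := by rw [← huv]; ring
  rw [this]
  exact neg_mem hv

/-- If a maximal ideal `m` is principal, the ideals containing a power of `m` are powers of `m`. -/
theorem eq_pow_of_pow_le {m J : Ideal R} (hm : m.IsMaximal) (hp : m.IsPrincipal) {k : ℕ}
    (hk : m ^ k ≤ J) : ∃ i, J = m ^ i := by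
  obtain ⟨x, hx⟩ := hp
  replace hx : m = Ideal.span {x} := hx
  by_cases h : J ≤ m ^ k
  · exact ⟨k, le_antisymm h hk⟩
  classical
  have hex : ∃ j, ¬ J ≤ m ^ j := ⟨k, h⟩
  have hmin : ∀ j < Nat.find hex, J ≤ m ^ j := fun j hj => not_not.1 (Nat.find_min hex hj)
  have hspec := Nat.find_spec hex
  obtain ⟨i, hi⟩ : ∃ i, Nat.find hex = i + 1 := Nat.exists_eq_succ_of_ne_zero fun h0 => by
    rw [h0] at hspec; simp at hspec
  rw [hi] at hmin hspec
  have hJi := hmin i (Nat.lt_succ_self i)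
  refine ⟨i, le_antisymm hJi ?_⟩
  obtain ⟨a, haJ, ha⟩ := Set.not_subset.1 hspec
  have hai : a ∈ m ^ i := hJi haJ
  rw [hx, Ideal.span_singleton_pow, Ideal.mem_span_singleton'] at hai
  obtain ⟨c, rfl⟩ := hai
  have hc : c ∉ m := fun hc => ha <| by
    rw [SetLike.mem_coe, pow_succ, mul_comm]
    refine Ideal.mul_mem_mul hc (Ideal.pow_mem_pow ?_ _)
    rw [hx]; exact Ideal.mem_span_singleton_self x
  obtain ⟨d, hd⟩ := exists_mul_sub_one_mem hm hc k
  rw [hx, Ideal.span_singleton_pow, Ideal.span_singleton_le_iff_mem]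
  have : x ^ i = d * (c * x ^ i) - x ^ i * (c * d - 1) := by ring
  rw [this]
  exact J.sub_mem (J.mul_mem_left _ haJ) (J.mul_mem_left _ (hk hd))

/-- In an artinian ring the powers of an ideal stabilize. -/
theorem exists_forall_pow_eq [IsArtinianRing R] (I : Ideal R) :
    ∃ n, 0 < n ∧ ∀ k, n ≤ k → I ^ k = I ^ n := by
  obtain ⟨n, hn⟩ := IsArtinian.monotone_stabilizes (R := R) (M := R)
    ⟨fun k => OrderDual.toDual (I ^ k), fun a b hab => Ideal.pow_le_pow_right hab⟩
  refine ⟨n + 1, n.succ_pos, fun k hk => ?_⟩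
  exact (hn k (by omega)).symm.trans (hn (n + 1) (by omega))

/-- In an artinian ring some positive power of any ideal is generated by an idempotent. -/
theorem exists_pow_eq_span_idempotent [IsArtinianRing R] (I : Ideal R) :
    ∃ n, 0 < n ∧ ∃ e : R, e * e = e ∧ I ^ n = Ideal.span {e} ∧ ∀ k, n ≤ k → I ^ k = I ^ n := by
  obtain ⟨n, hn0, hn⟩ := exists_forall_pow_eq I
  have hid : IsIdempotentElem (I ^ n) := by
    change I ^ n * I ^ n = I ^ n
    rw [← pow_add]; exact hn _ (by omega)
  obtain ⟨e, he, h⟩ := (Ideal.isIdempotentElem_iff_of_fg _ (IsNoetherian.noetherian _)).1 hid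
  exact ⟨n, hn0, e, he, h, hn⟩

/-- In an artinian ring, an ideal that is principal modulo its square is principal: if
`I ^ n = (e)` with `e` idempotent, then `I = (x) + (e)` is generated by `(1 - e) x + e`. -/
theorem isPrincipal_of_le_span_sup_sq [IsArtinianRing R] {I : Ideal R} {x : R} (hx : x ∈ I)
    (h : I ≤ Ideal.span {x} ⊔ I ^ 2) : I.IsPrincipal := by
  obtain ⟨n, hn0, e, he, hne, -⟩ := exists_pow_eq_span_idempotent I
  have key : ∀ j, I ≤ Ideal.span {x} ⊔ I ^ (j + 1) := by
    intro j
    induction j with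
    | zero => simp
    | succ j ih =>
      refine h.trans (sup_le le_sup_left ?_)
      calc I ^ 2 = I * I := pow_two I
        _ ≤ I * (Ideal.span {x} ⊔ I ^ (j + 1)) := Ideal.mul_mono_right ih
        _ ≤ _ := by
          rw [Ideal.mul_sup, ← pow_succ']
          exact sup_le_sup_right Ideal.mul_le_right _
  obtain ⟨j, rfl⟩ : ∃ j, n = j + 1 := ⟨n - 1, by omega⟩
  have heI : e ∈ I := Ideal.pow_le_self (Nat.succ_ne_zero j)
    (hne ▸ Ideal.mem_span_singleton_self e)
  refine ⟨(1 - e) * x + e, le_antisymm ?_ ?_⟩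
  · refine (key j).trans (sup_le ?_ (hne.le.trans ?_))
    · refine (Ideal.span_singleton_le_iff_mem _).2 (Ideal.mem_span_singleton'.2
        ⟨1 - e + e * x, ?_⟩)
      linear_combination (x ^ 2 * (-1) + 2 * x - 1) * he
    · refine (Ideal.span_singleton_le_iff_mem _).2 (Ideal.mem_span_singleton'.2 ⟨e, ?_⟩)
      linear_combination (1 - x) * he
  · exact (Ideal.span_singleton_le_iff_mem _).2
      (I.add_mem (I.mul_mem_left _ hx) heI)

/-- An artinian ring that is not a principal ideal ring has a maximal ideal `m` and elements
`x, y ∈ m` that are linearly independent in `m / m ^ 2`. -/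
theorem exists_independent_pair [IsArtinianRing R] (h : ¬ IsPrincipalIdealRing R) :
    ∃ m : Ideal R, m.IsMaximal ∧ ∃ x ∈ m, ∃ y ∈ m,
      ∀ a b, a * x + b * y ∈ m ^ 2 → a ∈ m ∧ b ∈ m := by
  obtain ⟨m, hprime, hm⟩ : ∃ m : Ideal R, m.IsPrime ∧ ¬ m.IsPrincipal := by
    by_contra! hcon
    exact h (IsPrincipalIdealRing.of_prime hcon)
  have hmax : m.IsMaximal := inferInstance
  obtain ⟨x, hx, hx2⟩ : ∃ x ∈ m, x ∉ m ^ 2 := by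
    by_contra! hcon
    exact hm (isPrincipal_of_le_span_sup_sq m.zero_mem (le_sup_of_le_right hcon))
  obtain ⟨y, hy, hy2⟩ : ∃ y ∈ m, y ∉ Ideal.span {x} ⊔ m ^ 2 := by
    by_contra! hcon
    exact hm (isPrincipal_of_le_span_sup_sq hx hcon)
  refine ⟨m, hmax, x, hx, y, hy, fun a b hab => ?_⟩
  have hb : b ∈ m := by
    by_contra hb
    obtain ⟨c, hc⟩ := exists_mul_sub_one_mem hmax hb 1
    rw [pow_one] at hc
    refine hy2 (Submodule.mem_sup.2 ⟨-(a * c) * x, Ideal.mem_span_singleton'.2 ⟨_, rfl⟩,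
      c * (a * x + b * y) - (b * c - 1) * y, ?_, by ring⟩)
    exact sub_mem (Ideal.mul_mem_left _ _ hab) (pow_two m ▸ Ideal.mul_mem_mul hc hy)
  refine ⟨by_contra fun ha => hx2 ?_, hb⟩
  obtain ⟨c, hc⟩ := exists_mul_sub_one_mem hmax ha 1
  rw [pow_one] at hc
  have : x = c * (a * x + b * y) - c * (b * y) - (a * c - 1) * x := by ring
  rw [this, pow_two]
  rw [pow_two] at hab
  exact sub_mem (sub_mem (Ideal.mul_mem_left _ _ hab)
    (Ideal.mul_mem_left _ _ (Ideal.mul_mem_mul hb hy))) (Ideal.mul_mem_mul hc hx)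

end Ideals

/-! ### Serial, principal and self-injective rings -/

section Serial

theorem isUniserial_of_isLocalRing {A : Type*} [CommRing A] [IsArtinianRing A] [IsLocalRing A]
    [IsPrincipalIdealRing A] : IsUniserial A A := by
  obtain ⟨k, hk⟩ := IsArtinianRing.isNilpotent_jacobson_bot (R := A)
  rw [IsLocalRing.jacobson_eq_maximalIdeal ⊥ bot_ne_top] at hk
  have hpow : ∀ J : Ideal A, ∃ i, J = IsLocalRing.maximalIdeal A ^ i := fun J =>
    eq_pow_of_pow_le inferInstance (IsPrincipalIdealRing.principal _)
      (hk.le.trans bot_le : IsLocalRing.maximalIdeal A ^ k ≤ J)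
  intro N P
  obtain ⟨i, hi⟩ := hpow N
  obtain ⟨j, hj⟩ := hpow P
  rw [hi, hj]
  exact (le_total j i).imp Ideal.pow_le_pow_right Ideal.pow_le_pow_right

theorem IsUniserial.isPrincipalIdealRing {A : Type*} [CommRing A] [IsArtinianRing A]
    (h : IsUniserial A A) : IsPrincipalIdealRing A := by
  have : IsBezout A := IsBezout.iff_span_pair_isPrincipal.2 fun x y => by
    rw [Ideal.span_insert]
    rcases h (Ideal.span {x}) (Ideal.span {y}) with hxy | hxy
    · rw [sup_eq_right.2 hxy]; exact ⟨y, rfl⟩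
    · rw [sup_eq_left.2 hxy]; exact ⟨x, rfl⟩
  exact ⟨fun I => IsBezout.isPrincipal_of_FG I (IsNoetherian.noetherian I)⟩

theorem IsSerialRing.isPrincipalIdealRing {R : Type u} [CommRing R] (h : IsSerialRing R) :
    IsPrincipalIdealRing R := by
  obtain ⟨n, A, _, hA, ⟨e⟩⟩ := h
  have := fun i => (hA i).1
  have := fun i => (hA i).2.isPrincipalIdealRing
  exact IsPrincipalIdealRing.of_surjective e.symm e.symm.surjective

theorem isSerialRing_of_isPrincipalIdealRing (R : Type u) [CommRing R] [IsArtinianRing R]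
    [IsPrincipalIdealRing R] : IsSerialRing R := by
  obtain ⟨n, ⟨f⟩⟩ := Finite.exists_equiv_fin (MaximalSpectrum R)
  refine ⟨n, fun i => Localization.AtPrime (f.symm i).asIdeal, inferInstance, fun i => ?_, ⟨?_⟩⟩
  · have hs := IsArtinianRing.localization_surjective (f.symm i).asIdeal.primeCompl
      (Localization.AtPrime (f.symm i).asIdeal)
    have := IsPrincipalIdealRing.of_surjective _ hs
    have := hs.isArtinianRing
    exact ⟨this, isUniserial_of_isLocalRing⟩
  · exact (MaximalSpectrum.toPiLocalizationEquiv R).toRingEquiv.trans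
      (RingEquiv.piCongrLeft' (fun m : MaximalSpectrum R => Localization.AtPrime m.asIdeal) f)

/-- In an artinian uniserial ring, the annihilator of an element determines divisibility. Say
`a = c * b`; the powers of `c` stabilize, so `c ^ n = c ^ (n + 1) * d`, and since multiplication
by `c` loses nothing on `b`, this yields `b = c * d * b`. -/
theorem IsUniserial.dvd_of_annihilator_le {A : Type*} [CommRing A] [IsArtinianRing A]
    (h : IsUniserial A A) {a b : A} (hab : ∀ r, r * a = 0 → r * b = 0) : a ∣ b := by
  rcases h (Ideal.span {a}) (Ideal.span {b}) with hle | hle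
  · obtain ⟨c, rfl⟩ := Ideal.span_singleton_le_span_singleton.1 hle
    obtain ⟨n, d, hd⟩ := IsArtinian.exists_pow_succ_smul_dvd c (1 : A)
    have key : ∀ k r, r * (c ^ k * b) = 0 → r * b = 0 := by
      intro k
      induction k with
      | zero => intro r hr; simpa using hr
      | succ k ih =>
        intro r hr
        refine ih r ?_
        rw [← mul_assoc]
        exact hab _ (by rw [← hr]; ring)
    have h0 := key n (1 - c * d) (by
      simp only [smul_eq_mul, mul_one, Nat.succ_eq_add_one, pow_succ] at hd
      linear_combination (-b) * hd)
    exact ⟨d, by linear_combination h0⟩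
  · exact Ideal.span_singleton_le_span_singleton.1 hle

theorem IsSerialRing.dvd_of_annihilator_le {R : Type u} [CommRing R] (h : IsSerialRing R) {a b : R}
    (hab : ∀ r, r * a = 0 → r * b = 0) : a ∣ b := by
  obtain ⟨n, A, _, hA, ⟨e⟩⟩ := h
  rw [← map_dvd_iff e, pi_dvd_iff]
  intro i
  have := (hA i).1
  refine (hA i).2.dvd_of_annihilator_le fun r hr => ?_
  have h1 : e.symm (Pi.single i r) * a = 0 := by
    rw [← map_eq_zero_iff e e.injective, map_mul, e.apply_symm_apply]
    ext j
    rcases eq_or_ne j i with rfl | hj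
    · simpa using hr
    · simp [hj]
  have h2 := congrArg (fun z => e z i) (hab _ h1)
  simpa using h2

/-- Over a principal ideal ring, Baer's criterion concerns extending `a ↦ b` from `(a)` to the
whole ring, which is possible exactly when `a` divides `b`. -/
theorem isSelfInjective_of_isPrincipalIdealRing (R : Type u) [CommRing R] [IsArtinianRing R]
    [IsPrincipalIdealRing R] : IsSelfInjective R := by
  refine Module.Baer.injective fun I g => ?_
  obtain ⟨a, rfl⟩ := IsPrincipalIdealRing.principal I
  have ha : a ∈ Submodule.span R {a} := Submodule.mem_span_singleton_self a
  obtain ⟨c, hc⟩ : a ∣ g ⟨a, ha⟩ :=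
    (isSerialRing_of_isPrincipalIdealRing R).dvd_of_annihilator_le fun r hr => by
      have : r • (⟨a, ha⟩ : Submodule.span R {a}) = 0 := Subtype.ext hr
      rw [← smul_eq_mul, ← map_smul, this, map_zero]
  refine ⟨LinearMap.toSpanSingleton R R c, fun x hx => ?_⟩
  obtain ⟨r, rfl⟩ := Submodule.mem_span_singleton.1 hx
  have : (⟨r • a, hx⟩ : Submodule.span R {a}) = r • ⟨a, ha⟩ := rfl
  rw [this, map_smul g, hc]
  simp [mul_assoc]

theorem IsSelfInjective.dvd_of_annihilator_le {R : Type u} [CommRing R] (h : IsSelfInjective R)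
    {a b : R} (hab : ∀ r, r * a = 0 → r * b = 0) : a ∣ b := by
  -- `r * a ↦ r * b` is a well defined map on `(a) ≅ R / ann a`
  let p := LinearMap.toSpanSingleton R R a
  let q := LinearMap.toSpanSingleton R R b
  have hpq : LinearMap.ker p ≤ LinearMap.ker q := fun r hr => by
    simpa [q] using hab r (by simpa [p] using hr)
  obtain ⟨g, hg⟩ := h.out ((LinearMap.ker p).liftQ p le_rfl)
    (LinearMap.ker_eq_bot.1 (Submodule.ker_liftQ_eq_bot _ _ _ le_rfl))
    ((LinearMap.ker p).liftQ q hpq)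
  have := hg (Submodule.Quotient.mk 1)
  rw [Submodule.liftQ_apply, Submodule.liftQ_apply] at this
  refine ⟨g 1, ?_⟩
  simp only [p, q, LinearMap.toSpanSingleton_apply, one_smul] at this
  rw [← this, ← smul_eq_mul, ← map_smul, smul_eq_mul, mul_one]

theorem isPrincipalIdealRing_of_isSelfInjective_quotient (R : Type u) [CommRing R]
    [IsArtinianRing R] (h : ∀ I : Ideal R, I ≠ ⊤ → IsSelfInjective (R ⧸ I)) :
    IsPrincipalIdealRing R := by
  by_contra hR
  obtain ⟨m, hm, x, hx, y, hy, hxy⟩ := exists_independent_pair hR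
  have hone : (1 : R) ∉ m := (Ideal.ne_top_iff_one m).1 hm.ne_top
  have hinj := h (m ^ 2) fun h2 => hm.ne_top (top_le_iff.1 (h2 ▸ Ideal.pow_le_self two_ne_zero))
  obtain ⟨c, hc⟩ := hinj.dvd_of_annihilator_le (a := Ideal.Quotient.mk _ x)
    (b := Ideal.Quotient.mk _ y) fun r hr => by
      obtain ⟨r, rfl⟩ := Ideal.Quotient.mk_surjective r
      rw [← map_mul, Ideal.Quotient.eq_zero_iff_mem] at hr ⊢
      rw [pow_two]
      exact Ideal.mul_mem_mul (hxy r 0 (by simpa using hr)).1 hy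
  obtain ⟨c, rfl⟩ := Ideal.Quotient.mk_surjective c
  rw [← map_mul, Ideal.Quotient.mk_eq_mk_iff_sub_mem] at hc
  exact hone (hxy (-c) 1 (by convert hc using 1; ring)).2

end Serial

/-! ### Composition factors of indecomposable modules -/

section Indecomposable

variable {R : Type*} [CommRing R] {M : Type*} [AddCommGroup M] [Module R M]

theorem IsIndecomposable.mem_annihilator_of_idempotent (hM : IsIndecomposable R M) {e : R}
    (he : e * e = e) : e ∈ Module.annihilator R M ∨ 1 - e ∈ Module.annihilator R M := by
  have hid : IsIdempotentElem (LinearMap.lsmul R M e) := by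
    ext v
    simp [smul_smul, he]
  refine (hM.2 _ _ (LinearMap.IsIdempotentElem.isCompl hid)).imp (fun h => ?_) (fun h => ?_)
  · rw [LinearMap.range_eq_bot] at h
    exact Module.mem_annihilator.2 fun v => by simpa using LinearMap.congr_fun h v
  · refine Module.mem_annihilator.2 fun v => ?_
    have : (1 - e) • v ∈ LinearMap.ker (LinearMap.lsmul R M e) := by
      have h0 : e * (1 - e) = 0 := by rw [mul_sub, he, mul_one, sub_self]
      rw [LinearMap.mem_ker, LinearMap.lsmul_apply, smul_smul, h0, zero_smul]
    rwa [h, Submodule.mem_bot] at this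

/-- An indecomposable module over an artinian ring is supported at a single maximal ideal. -/
theorem IsIndecomposable.exists_pow_le_annihilator [IsArtinianRing R] (hM : IsIndecomposable R M) :
    ∃ (m : Ideal R) (k : ℕ), m.IsMaximal ∧ m ^ k ≤ Module.annihilator R M := by
  have := hM.1
  obtain ⟨m, hm, hle⟩ := Ideal.exists_le_maximal (Module.annihilator R M) fun h =>
    not_subsingleton M (Module.annihilator_eq_top_iff.1 h)
  obtain ⟨n, hn0, e, he, hne, -⟩ := exists_pow_eq_span_idempotent m
  have hem : e ∈ m := Ideal.pow_le_self hn0.ne' (hne ▸ Ideal.mem_span_singleton_self e)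
  refine ⟨m, n, hm, ?_⟩
  rw [hne, Ideal.span_singleton_le_iff_mem]
  refine (hM.mem_annihilator_of_idempotent he).resolve_right fun h => ?_
  exact (Ideal.ne_top_iff_one m).1 hm.ne_top (by simpa using m.add_mem (hle h) hem)

/-- A nonzero quotient ring `R ⧸ J` is indecomposable if `J` contains a power of a maximal ideal,
because it is then a local ring. -/
theorem isIndecomposable_quotient {m J : Ideal R} (hm : m.IsMaximal) {k : ℕ} (hk : m ^ k ≤ J)
    (hJ : J ≠ ⊤) : IsIndecomposable R (R ⧸ J) := by
  refine ⟨Ideal.Quotient.nontrivial_iff.2 hJ, fun N P hNP => ?_⟩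
  -- a proper submodule of `R ⧸ J` does not see any element outside `m`
  have key : ∀ N : Submodule R (R ⧸ J), N ≠ ⊤ → N.comap J.mkQ ≤ m := by
    intro N hN a ha
    by_contra ham
    obtain ⟨c, hc⟩ := exists_mul_sub_one_mem hm ham k
    refine hN (eq_top_iff.2 ?_)
    have h1 : J.mkQ 1 ∈ N := by
      have h2 : J.mkQ (c • a) ∈ N := by rw [map_smul]; exact N.smul_mem c ha
      have h3 : J.mkQ 1 = J.mkQ (c • a) := by
        rw [← sub_eq_zero, ← map_sub, Submodule.mkQ_apply, Submodule.Quotient.mk_eq_zero]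
        have := J.neg_mem (hk hc)
        rwa [neg_sub, mul_comm] at this
      rwa [h3]
    rintro v -
    obtain ⟨r, rfl⟩ := J.mkQ_surjective v
    rw [← mul_one r, ← smul_eq_mul, map_smul]
    exact N.smul_mem r h1
  by_cases hN : N = ⊤
  · exact Or.inr (by simpa [hN] using hNP.inf_eq_bot)
  by_cases hP : P = ⊤
  · exact Or.inl (by simpa [hP] using hNP.inf_eq_bot)
  exfalso
  obtain ⟨a, ha, b, hb, hab⟩ := Submodule.mem_sup.1
    (hNP.sup_eq_top ▸ Submodule.mem_top : J.mkQ 1 ∈ N ⊔ P)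
  obtain ⟨a, rfl⟩ := J.mkQ_surjective a
  obtain ⟨b, rfl⟩ := J.mkQ_surjective b
  have h1 := m.add_mem (key N hN ha) (key P hP hb)
  have h2 : (1 : R) - (a + b) ∈ m := by
    refine key N hN ?_
    rw [Submodule.mem_comap, map_sub, map_add, hab, sub_self]
    exact N.zero_mem
  exact (Ideal.ne_top_iff_one m).1 hm.ne_top (by simpa using m.add_mem h2 h1)

theorem nonempty_linearEquiv_of_isSimpleModule [IsSimpleModule R M] {m : Ideal R}
    (hm : m.IsMaximal) {k : ℕ} (hk : m ^ k ≤ Module.annihilator R M) :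
    Nonempty (M ≃ₗ[R] R ⧸ m) := by
  obtain ⟨I, hI, ⟨e⟩⟩ := isSimpleModule_iff_quot_maximal.1 ‹IsSimpleModule R M›
  rw [e.annihilator_eq, Ideal.annihilator_quotient] at hk
  have := hI.isPrime
  obtain rfl := hm.eq_of_le hI.ne_top (Ideal.IsPrime.le_of_pow_le hk)
  exact ⟨e⟩

/-- If a power of the maximal ideal `m` kills `M`, then all composition factors of `M` are isomorphic
to `R ⧸ m`. -/
theorem nonempty_factor_linearEquiv {m : Ideal R} (hm : m.IsMaximal) {k : ℕ}
    (hk : m ^ k ≤ Module.annihilator R M) (s : CompositionSeries (Submodule R M))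
    (i : Fin s.length) :
    Nonempty ((s i.succ ⧸ (s i.castSucc).submoduleOf (s i.succ)) ≃ₗ[R] R ⧸ m) := by
  have hcov : s i.castSucc ⋖ s i.succ := s.step i
  have : IsSimpleModule R (s i.succ ⧸ (s i.castSucc).submoduleOf (s i.succ)) :=
    (covBy_iff_quot_is_simple hcov.le).1 hcov
  refine nonempty_linearEquiv_of_isSimpleModule hm (hk.trans ?_)
  exact ((s i.succ).subtype.annihilator_le_of_injective (s i.succ).injective_subtype).trans
    (LinearMap.annihilator_le_of_surjective _ (Submodule.mkQ_surjective _))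

theorem multiplicity_eq_length {m : Ideal R} (hm : m.IsMaximal) {k : ℕ}
    (hk : m ^ k ≤ Module.annihilator R M) (hM : IsFiniteLength R M)
    {S : Type*} [AddCommGroup S] [Module R S] (e : S ≃ₗ[R] R ⧸ m) :
    (multiplicity R M S : ℕ∞) = Module.length R M := by
  obtain ⟨s, hs⟩ := isFiniteLength_iff_exists_compositionSeries.1 hM
  rw [multiplicity_eq_factorCount hs, ← Module.length_compositionSeries s hs.1 hs.2, factorCount]
  have : ∀ i : Fin s.length,
      Nonempty (S ≃ₗ[R] (s i.succ ⧸ (s i.castSucc).submoduleOf (s i.succ))) := fun i =>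
    (nonempty_factor_linearEquiv hm hk s i).map fun f => e.trans f.symm
  rw [Nat.card_congr (Equiv.subtypeUnivEquiv this), Nat.card_fin]

theorem nonempty_linearEquiv_of_multiplicity_ne_zero {m : Ideal R} (hm : m.IsMaximal) {k : ℕ}
    (hk : m ^ k ≤ Module.annihilator R M) (hM : IsFiniteLength R M)
    {S : Type*} [AddCommGroup S] [Module R S] (h : multiplicity R M S ≠ 0) :
    Nonempty (S ≃ₗ[R] R ⧸ m) := by
  obtain ⟨s, hs⟩ := isFiniteLength_iff_exists_compositionSeries.1 hM
  rw [multiplicity_eq_factorCount hs, factorCount] at h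
  obtain ⟨⟨i, ⟨f⟩⟩⟩ := (Nat.card_ne_zero.1 h).1
  exact (nonempty_factor_linearEquiv hm hk s i).map f.trans

/-- Additivity of length along `0 → R ⧸ m → R ⧸ m ^ 2 → R ⧸ (x, m ^ 2) → 0`, where the first map is
multiplication by `x`. -/
theorem length_quotient_sq_eq {m : Ideal R} (hm : m.IsMaximal) {x : R} (hx : x ∈ m)
    (hx2 : x ∉ m ^ 2) :
    Module.length R (R ⧸ m ^ 2) = 1 + Module.length R (R ⧸ (Ideal.span {x} ⊔ m ^ 2)) := by
  have : IsSimpleModule R (R ⧸ m) :=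
    isSimpleModule_iff_quot_maximal.2 ⟨_, hm, ⟨LinearEquiv.refl _ _⟩⟩
  have hker : m ≤ LinearMap.ker (LinearMap.toSpanSingleton R (R ⧸ m ^ 2)
      (Submodule.Quotient.mk x)) := fun r hr => by
    rw [LinearMap.mem_ker, LinearMap.toSpanSingleton_apply, ← Submodule.Quotient.mk_smul,
      Submodule.Quotient.mk_eq_zero, pow_two]
    exact Ideal.mul_mem_mul hr hx
  have hne : m.liftQ _ hker ≠ 0 := fun h0 => hx2 <| by
    have := LinearMap.congr_fun h0 (Submodule.Quotient.mk 1)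
    rwa [Submodule.liftQ_apply, LinearMap.toSpanSingleton_apply, one_smul, LinearMap.zero_apply,
      Submodule.Quotient.mk_eq_zero] at this
  rw [Module.length_eq_add_of_exact (m.liftQ _ hker)
    (Submodule.factor (le_sup_right : m ^ 2 ≤ Ideal.span {x} ⊔ m ^ 2))
    (LinearMap.injective_of_ne_zero hne) (Submodule.factor_surjective _) ?_, Module.length_eq_one]
  intro r
  obtain ⟨r, rfl⟩ := Submodule.Quotient.mk_surjective _ r
  rw [← Submodule.mkQ_apply, Submodule.factor_mk, Submodule.mkQ_apply,
    Submodule.Quotient.mk_eq_zero, Submodule.mem_sup]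
  constructor
  · rintro ⟨_, hu, v, hv, rfl⟩
    obtain ⟨c, rfl⟩ := Ideal.mem_span_singleton'.1 hu
    refine ⟨Submodule.Quotient.mk c, ?_⟩
    rw [Submodule.liftQ_apply, LinearMap.toSpanSingleton_apply, ← Submodule.Quotient.mk_smul,
      Submodule.mkQ_apply, Submodule.Quotient.eq]
    simpa using hv
  · rintro ⟨c, hc⟩
    obtain ⟨c, rfl⟩ := Submodule.Quotient.mk_surjective _ c
    rw [Submodule.liftQ_apply, LinearMap.toSpanSingleton_apply, ← Submodule.Quotient.mk_smul,
      Submodule.mkQ_apply, Submodule.Quotient.eq] at hc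
    exact ⟨c * x, Ideal.mem_span_singleton'.2 ⟨c, rfl⟩, r - c * x,
      by simpa using (m ^ 2).neg_mem hc, by ring⟩

end Indecomposable

/-! ### Indecomposable modules over principal ideal rings -/

section PrincipalIdealRing

variable {R : Type u} [CommRing R] [IsArtinianRing R]

/-- If `R ⧸ ann M` is self-injective and `v ∈ M` has the same annihilator as the indecomposable
module `M`, then `v` generates `M`, since the submodule generated by `v` is a direct summand. -/
theorem IsIndecomposable.span_singleton_eq_top {R : Type u} [CommRing R] {M : Type u}
    [AddCommGroup M] [Module R M] (hM : IsIndecomposable R M)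
    (hinj : IsSelfInjective (R ⧸ Module.annihilator R M)) {v : M}
    (hv : ∀ r : R, r • v = 0 → r ∈ Module.annihilator R M) : Submodule.span R {v} = ⊤ := by
  let _ : Module (R ⧸ Module.annihilator R M) M := Module.quotientAnnihilator
  have hmk : ∀ (r : R) (w : M), Ideal.Quotient.mk (Module.annihilator R M) r • w = r • w :=
    fun _ _ => rfl
  obtain ⟨g, hg⟩ := hinj.out (LinearMap.toSpanSingleton (R ⧸ Module.annihilator R M) M v)
    ((injective_iff_map_eq_zero _).2 fun r hr => by
      obtain ⟨r, rfl⟩ := Ideal.Quotient.mk_surjective r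
      exact Ideal.Quotient.eq_zero_iff_mem.2 (hv r hr)) LinearMap.id
  simp only [LinearMap.toSpanSingleton_apply, LinearMap.id_apply] at hg
  let P : Submodule R M :=
    { carrier := {w | g w = 0}
      add_mem' := fun {a b} ha hb => by
        simp only [Set.mem_ofPred_eq] at ha hb ⊢
        rw [map_add, ha, hb, add_zero]
      zero_mem' := map_zero g
      smul_mem' := fun r w hw => by
        simp only [Set.mem_ofPred_eq] at hw ⊢
        rw [← hmk, map_smul, hw, smul_zero] }
  have hcompl : IsCompl (Submodule.span R {v}) P := by
    refine ⟨Submodule.disjoint_def.2 fun w hw hwP => ?_,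
      codisjoint_iff.2 (eq_top_iff.2 fun w _ => ?_)⟩
    · obtain ⟨r, rfl⟩ := Submodule.mem_span_singleton.1 hw
      have h0 : g (r • v) = 0 := hwP
      rw [← hmk, hg] at h0
      rw [← hmk, h0, zero_smul]
    · obtain ⟨r, hr⟩ := Ideal.Quotient.mk_surjective (g w)
      refine Submodule.mem_sup.2 ⟨r • v, Submodule.smul_mem _ _
        (Submodule.mem_span_singleton_self v), w - r • v, ?_, by abel⟩
      change g (w - r • v) = 0
      rw [map_sub, ← hmk, hg, hr, sub_self]
  rcases hM.2 _ _ hcompl with h | h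
  · have := hM.1
    have hv0 : v = 0 := Submodule.span_singleton_eq_bot.1 h
    have h1 := hv 1 (by rw [hv0, smul_zero])
    obtain ⟨w, hw⟩ := exists_ne (0 : M)
    exact absurd (by simpa using Module.mem_annihilator.1 h1 w) hw
  · rw [← hcompl.sup_eq_top, h, sup_bot_eq]

/-- Over an artinian principal ideal ring every indecomposable module is of the form `R ⧸ m ^ i`
with `m` maximal. -/
theorem IsIndecomposable.exists_linearEquiv_quotient_pow [IsPrincipalIdealRing R] {M : Type u}
    [AddCommGroup M] [Module R M] (hM : IsIndecomposable R M) :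
    ∃ (m : Ideal R) (i : ℕ), m.IsMaximal ∧ Nonempty (M ≃ₗ[R] R ⧸ m ^ i) := by
  obtain ⟨m, k, hm, hk⟩ := hM.exists_pow_le_annihilator
  have hpow : ∀ J : Ideal R, Module.annihilator R M ≤ J → ∃ i, J = m ^ i := fun J hJ =>
    eq_pow_of_pow_le hm (IsPrincipalIdealRing.principal m) (hk.trans hJ)
  have hann : ∀ v : M, Module.annihilator R M ≤ LinearMap.ker (LinearMap.toSpanSingleton R M v) :=
    fun v r hr => by simpa using Module.mem_annihilator.1 hr v
  -- the annihilators of the elements of `M` are totally ordered, so the smallest one kills `M`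
  obtain ⟨_, ⟨v, rfl⟩, hmin⟩ := WellFounded.has_min (wellFounded_lt (α := Ideal R))
    (Set.range fun v : M => LinearMap.ker (LinearMap.toSpanSingleton R M v)) ⟨_, 0, rfl⟩
  have hle : ∀ w : M, LinearMap.ker (LinearMap.toSpanSingleton R M v) ≤
      LinearMap.ker (LinearMap.toSpanSingleton R M w) := by
    intro w
    obtain ⟨i, hi⟩ := hpow _ (hann v)
    obtain ⟨j, hj⟩ := hpow _ (hann w)
    have hnot := hmin _ ⟨w, rfl⟩
    rcases le_total j i with hij | hij
    · rw [hi, hj]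
      exact Ideal.pow_le_pow_right hij
    · have hwv : LinearMap.ker (LinearMap.toSpanSingleton R M w) ≤
          LinearMap.ker (LinearMap.toSpanSingleton R M v) := by
        rw [hi, hj]
        exact Ideal.pow_le_pow_right hij
      exact not_lt_iff_le_imp_ge.1 hnot hwv
  have hv : ∀ r : R, r • v = 0 → r ∈ Module.annihilator R M := fun r hr =>
    Module.mem_annihilator.2 fun w => by simpa using hle w (by simpa using hr)
  have := IsPrincipalIdealRing.of_surjective (Ideal.Quotient.mk (Module.annihilator R M))
    Ideal.Quotient.mk_surjective
  have htop := hM.span_singleton_eq_top (isSelfInjective_of_isPrincipalIdealRing _) hv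
  have hsurj : Function.Surjective (LinearMap.toSpanSingleton R M v) :=
    LinearMap.range_eq_top.1 (by rw [← LinearMap.span_singleton_eq_range, htop])
  obtain ⟨i, hi⟩ := hpow _ (hann v)
  exact ⟨m, i, hm, ⟨((LinearMap.toSpanSingleton R M v).quotKerEquivOfSurjective hsurj).symm.trans
    (Submodule.quotEquivOfEq _ _ hi)⟩⟩

variable (R)

/-- There are only finitely many powers of maximal ideals in an artinian ring: it has finitely many
maximal ideals, and the powers of each of them stabilize. -/
theorem finite_setOf_pow_isMaximal : {J : Ideal R | ∃ m i, m.IsMaximal ∧ J = m ^ i}.Finite := by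
  have : {J : Ideal R | ∃ m i, m.IsMaximal ∧ J = m ^ i} ⊆
      ⋃ m : MaximalSpectrum R, Set.range fun i : ℕ => m.asIdeal ^ i := by
    rintro J ⟨m, i, hm, rfl⟩
    exact Set.mem_iUnion.2 ⟨⟨m, hm⟩, i, rfl⟩
  refine (Set.finite_iUnion fun m => ?_).subset this
  obtain ⟨n, -, hn⟩ := exists_forall_pow_eq m.asIdeal
  refine ((Set.finite_Iic n).image fun i : ℕ => m.asIdeal ^ i).subset ?_
  rintro _ ⟨i, rfl⟩
  rcases le_total i n with h | h
  · exact ⟨i, h, rfl⟩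
  · exact ⟨n, Set.mem_Iic.2 le_rfl, (hn i h).symm⟩

theorem hasFiniteRepresentationType_of_isPrincipalIdealRing [IsPrincipalIdealRing R] :
    HasFiniteRepresentationType R := by
  have := (finite_setOf_pow_isMaximal R).to_subtype
  obtain ⟨n, ⟨f⟩⟩ := Finite.exists_equiv_fin {J : Ideal R | ∃ m i, m.IsMaximal ∧ J = m ^ i}
  refine ⟨n, fun i => ModuleCat.of R (R ⧸ (f.symm i : Ideal R)), fun M _ _ _ hM => ?_⟩
  obtain ⟨m, i, hm, ⟨e⟩⟩ := hM.exists_linearEquiv_quotient_pow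
  exact ⟨f ⟨m ^ i, m, i, hm, rfl⟩,
    ⟨e.trans (Submodule.quotEquivOfEq _ _ (by rw [Equiv.symm_apply_apply]))⟩⟩

theorem isFiniteLength_of_finite {M : Type*} [AddCommGroup M] [Module R M] [Module.Finite R M] :
    IsFiniteLength R M :=
  isFiniteLength_iff_isNoetherian_isArtinian.2 ⟨inferInstance, inferInstance⟩

variable {R} in
theorem nonempty_linearEquiv_quotient_of_le {I J : Ideal R} (hIJ : I ≤ J)
    (h : Module.length R (R ⧸ I) = Module.length R (R ⧸ J)) :
    Nonempty ((R ⧸ I) ≃ₗ[R] R ⧸ J) := by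
  refine ⟨Submodule.quotEquivOfEq _ _ (by_contra fun hne => ?_)⟩
  have hlt : I < J := lt_of_le_of_ne hIJ hne
  rw [Module.length_quotient, Module.length_quotient] at h
  exact (Order.coheight_strictAnti hlt (lt_top_iff_ne_top.2 (by
    rw [← Module.length_quotient]; exact Module.length_ne_top))).ne h.symm

theorem determinedByCompositionFactors_of_isPrincipalIdealRing [IsPrincipalIdealRing R] :
    DeterminedByCompositionFactors R := by
  intro M N _ _ _ _ hMl hNl hM hN h
  obtain ⟨m, i, hm, ⟨e⟩⟩ := hM.exists_linearEquiv_quotient_pow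
  obtain ⟨m', j, hm', ⟨e'⟩⟩ := hN.exists_linearEquiv_quotient_pow
  have hMa : m ^ i ≤ Module.annihilator R M := by
    rw [e.annihilator_eq, Ideal.annihilator_quotient]
  have hNa : m' ^ j ≤ Module.annihilator R N := by
    rw [e'.annihilator_eq, Ideal.annihilator_quotient]
  have hsimple : ∀ {p : Ideal R}, p.IsMaximal → IsSimpleModule R (R ⧸ p) := fun hp =>
    isSimpleModule_iff_quot_maximal.2 ⟨_, hp, ⟨LinearEquiv.refl _ _⟩⟩
  have hS := h (R ⧸ m) (hsimple hm)
  have hlM := multiplicity_eq_length hm hMa hMl (LinearEquiv.refl R (R ⧸ m))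
  have hpos : multiplicity R M (R ⧸ m) ≠ 0 := fun h0 => by
    have := hM.1
    rw [h0] at hlM
    exact (Module.length_pos (R := R) (M := M)).ne hlM
  obtain ⟨f⟩ := nonempty_linearEquiv_of_multiplicity_ne_zero hm' hNa hNl (hS ▸ hpos)
  have hmm' : m = m' := by
    rw [← Ideal.annihilator_quotient (I := m), f.annihilator_eq, Ideal.annihilator_quotient]
  subst hmm'
  have hlN := multiplicity_eq_length hm hNa hNl (LinearEquiv.refl R (R ⧸ m))
  have hl : Module.length R (R ⧸ m ^ i) = Module.length R (R ⧸ m ^ j) := by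
    rw [← e.length_eq, ← e'.length_eq, ← hlM, ← hlN, hS]
  rcases le_total i j with hij | hij
  · obtain ⟨g⟩ := nonempty_linearEquiv_quotient_of_le (Ideal.pow_le_pow_right hij) hl.symm
    exact ⟨e.trans (g.symm.trans e'.symm)⟩
  · obtain ⟨g⟩ := nonempty_linearEquiv_quotient_of_le (Ideal.pow_le_pow_right hij) hl
    exact ⟨e.trans (g.trans e'.symm)⟩

/-- If `x, y ∈ m` are independent modulo `m ^ 2`, then `R ⧸ ((x) + m ^ 2)` and
`R ⧸ ((y) + m ^ 2)` are indecomposable and have the same composition factors, but different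
annihilators. -/
theorem isPrincipalIdealRing_of_determinedByCompositionFactors
    (h : DeterminedByCompositionFactors R) : IsPrincipalIdealRing R := by
  by_contra hR
  obtain ⟨m, hm, x, hx, y, hy, hxy⟩ := exists_independent_pair hR
  have hone : (1 : R) ∉ m := (Ideal.ne_top_iff_one m).1 hm.ne_top
  have hx2 : x ∉ m ^ 2 := fun hx2 => hone (hxy 1 0 (by simpa using hx2)).1
  have hy2 : y ∉ m ^ 2 := fun hy2 => hone (hxy 0 1 (by simpa using hy2)).2
  have hind : ∀ z ∈ m, IsIndecomposable R (R ⧸ (Ideal.span {z} ⊔ m ^ 2)) := fun z hz =>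
    isIndecomposable_quotient hm le_sup_right fun htop => hm.ne_top <| top_le_iff.1 <|
      htop ▸ sup_le ((Ideal.span_singleton_le_iff_mem _).2 hz) (Ideal.pow_le_self two_ne_zero)
  have hann : ∀ z, m ^ 2 ≤ Module.annihilator R (R ⧸ (Ideal.span {z} ⊔ m ^ 2)) := fun z => by
    rw [Ideal.annihilator_quotient]; exact le_sup_right
  have hfl : ∀ z, IsFiniteLength R (R ⧸ (Ideal.span {z} ⊔ m ^ 2)) := fun z =>
    isFiniteLength_of_finite R
  have hl : Module.length R (R ⧸ (Ideal.span {x} ⊔ m ^ 2)) =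
      Module.length R (R ⧸ (Ideal.span {y} ⊔ m ^ 2)) :=
    ENat.add_right_injective_of_ne_top ENat.one_ne_top
      ((length_quotient_sq_eq hm hx hx2).symm.trans (length_quotient_sq_eq hm hy hy2))
  obtain ⟨e⟩ := h _ _ (hfl x) (hfl y) (hind x hx) (hind y hy) fun S _ _ _ => by
    by_cases hS : Nonempty (S ≃ₗ[R] R ⧸ m)
    · obtain ⟨f⟩ := hS
      rw [← Nat.cast_inj (R := ℕ∞), multiplicity_eq_length hm (hann x) (hfl x) f,
        multiplicity_eq_length hm (hann y) (hfl y) f, hl]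
    · rw [not_not.1 (mt (nonempty_linearEquiv_of_multiplicity_ne_zero hm (hann x) (hfl x)) hS),
        not_not.1 (mt (nonempty_linearEquiv_of_multiplicity_ne_zero hm (hann y) (hfl y)) hS)]
  have heq := e.annihilator_eq
  rw [Ideal.annihilator_quotient, Ideal.annihilator_quotient] at heq
  obtain ⟨_, hu, v, hv, huv⟩ := Submodule.mem_sup.1
    (heq ▸ Ideal.mem_sup_left (Ideal.mem_span_singleton_self x) : x ∈ Ideal.span {y} ⊔ m ^ 2)
  obtain ⟨c, rfl⟩ := Ideal.mem_span_singleton'.1 hu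
  exact hone (hxy 1 (-c) (by convert hv using 1; linear_combination -huv)).1

end PrincipalIdealRing

/-! ### Indecomposable modules over rings that are not principal -/

section KroneckerModule

open Polynomial

variable {R : Type u} [CommRing R]

theorem mem_smul_of_isCompl {M : Type*} [AddCommGroup M] [Module R M] {N P : Submodule R M}
    (h : IsCompl N P) (m : Ideal R) {a b : M} (ha : a ∈ N) (hb : b ∈ P)
    (hab : a + b ∈ m • (⊤ : Submodule R M)) : a ∈ m • N := by
  rw [← h.sup_eq_top, Submodule.smul_sup] at hab
  obtain ⟨c, hc, d, hd, hcd⟩ := Submodule.mem_sup.1 hab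
  have h1 : a - c = d - b := by
    rw [sub_eq_sub_iff_add_eq_add, ← hcd, add_comm]
  have h2 : a - c = 0 := Submodule.disjoint_def.1 h.disjoint _
    (N.sub_mem ha (Submodule.smul_le_right hc))
    (h1 ▸ P.sub_mem (Submodule.smul_le_right hd) hb)
  rwa [sub_eq_zero.1 h2]

theorem le_total_of_X_pow_mem {k : Type*} [Field k] {n : ℕ} {A B : Ideal k[X]}
    (hA : X ^ n ∈ A) (hB : X ^ n ∈ B) : A ≤ B ∨ B ≤ A := by
  have hmax : (Ideal.span {X} : Ideal k[X]).IsMaximal :=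
    PrincipalIdealRing.isMaximal_of_irreducible irreducible_X
  have hpow : ∀ A : Ideal k[X], X ^ n ∈ A → ∃ i, A = Ideal.span {X} ^ i := fun A hA =>
    eq_pow_of_pow_le hmax ⟨X, rfl⟩ (k := n) (by
      rwa [Ideal.span_singleton_pow, Ideal.span_singleton_le_iff_mem])
  obtain ⟨i, rfl⟩ := hpow A hA
  obtain ⟨j, rfl⟩ := hpow B hB
  exact (le_total j i).imp Ideal.pow_le_pow_right Ideal.pow_le_pow_right

/-- The ideal `(X ^ n, x + y X) + m ^ 2 R[X]` of `R[X]`. -/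
noncomputable def kroneckerIdeal (m : Ideal R) (x y : R) (n : ℕ) : Ideal R[X] :=
  Ideal.span {X ^ n} ⊔ Ideal.span {C x + C y * X} ⊔ (m ^ 2).map C

/-- The `R`-module `R[X] / (X ^ n, x + y X, m ^ 2)`. It satisfies
`x v = - y (X v)`; if `x` and `y` are independent in `m / m ^ 2`, then as maps from the top
`M / m M ≅ k[X] / (X ^ n)` to `m M`, multiplication by `x` and by `y` differ by a nilpotent Jordan
block of size `n`, up to sign. -/
abbrev KroneckerModule (m : Ideal R) (x y : R) (n : ℕ) : Type u :=
  R[X] ⧸ kroneckerIdeal m x y n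

/-- The ideal `(X ^ n) + m R[X]` of `R[X]`, described by coefficients. -/
noncomputable def lowCoeffIdeal (m : Ideal R) (n : ℕ) : Ideal R[X] :=
  (Ideal.span {X ^ n}).comap (mapRingHom (Ideal.Quotient.mk m))

theorem mem_lowCoeffIdeal {m : Ideal R} {n : ℕ} {f : R[X]} :
    f ∈ lowCoeffIdeal m n ↔ ∀ d < n, f.coeff d ∈ m := by
  rw [lowCoeffIdeal, Ideal.mem_comap, Ideal.mem_span_singleton, X_pow_dvd_iff]
  simp only [coe_mapRingHom, coeff_map, Ideal.Quotient.eq_zero_iff_mem]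

variable {m : Ideal R} {x y : R} {n : ℕ}

theorem map_C_le_lowCoeffIdeal : m.map C ≤ lowCoeffIdeal m n := fun _ hf =>
  mem_lowCoeffIdeal.2 fun d _ => Ideal.mem_map_C_iff.1 hf d

theorem kroneckerIdeal_le_lowCoeffIdeal (hx : x ∈ m) (hy : y ∈ m) :
    kroneckerIdeal m x y n ≤ lowCoeffIdeal m n := by
  refine sup_le (sup_le ?_ ?_) ?_
  · rw [Ideal.span_singleton_le_iff_mem, lowCoeffIdeal, Ideal.mem_comap]
    simp
  · rw [Ideal.span_singleton_le_iff_mem]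
    exact map_C_le_lowCoeffIdeal (add_mem (Ideal.mem_map_of_mem C hx)
      (Ideal.mul_mem_right _ _ (Ideal.mem_map_of_mem C hy)))
  · exact (Ideal.map_mono (Ideal.pow_le_self two_ne_zero)).trans map_C_le_lowCoeffIdeal

theorem smul_mk_eq_mk (r : R) (f : R[X]) :
    r • Ideal.Quotient.mk (kroneckerIdeal m x y n) f = Ideal.Quotient.mk _ (C r * f) := by
  rw [← smul_eq_C_mul]
  rfl

theorem X_pow_mem_kroneckerIdeal : X ^ n ∈ kroneckerIdeal m x y n :=
  Ideal.mem_sup_left (Ideal.mem_sup_left (Ideal.mem_span_singleton_self _))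

/-- The ideal `(X ^ n) + m R[X]` is the preimage of `m M` for `M` the Kronecker module. -/
theorem mk_mem_smul_top_iff (hx : x ∈ m) (hy : y ∈ m) {f : R[X]} :
    Ideal.Quotient.mk (kroneckerIdeal m x y n) f ∈ m • (⊤ : Submodule R (KroneckerModule m x y n)) ↔
      f ∈ lowCoeffIdeal m n := by
  constructor
  · intro hf
    have : ∀ v ∈ m • (⊤ : Submodule R (KroneckerModule m x y n)), ∀ g,
        Ideal.Quotient.mk (kroneckerIdeal m x y n) g = v → g ∈ lowCoeffIdeal m n := by
      intro v hv
      induction hv using Submodule.smul_induction_on' with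
      | smul r hr w _ =>
        intro g hg
        obtain ⟨w, rfl⟩ := Ideal.Quotient.mk_surjective w
        rw [smul_mk_eq_mk, Ideal.Quotient.mk_eq_mk_iff_sub_mem] at hg
        have := add_mem (kroneckerIdeal_le_lowCoeffIdeal hx hy hg)
          (Ideal.mul_mem_right w _ (map_C_le_lowCoeffIdeal (Ideal.mem_map_of_mem C hr)))
        rwa [sub_add_cancel] at this
      | add v _ w _ ihv ihw =>
        intro g hg
        obtain ⟨w, rfl⟩ := Ideal.Quotient.mk_surjective w
        have := add_mem (ihv (g - w) (by rw [map_sub, hg, add_sub_cancel_right])) (ihw w rfl)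
        rwa [sub_add_cancel] at this
    exact this _ hf f rfl
  · intro hf
    rw [lowCoeffIdeal, Ideal.mem_comap, Ideal.mem_span_singleton] at hf
    obtain ⟨q, hq⟩ := hf
    obtain ⟨q, rfl⟩ := map_surjective _ Ideal.Quotient.mk_surjective q
    have hmap : m.map C = RingHom.ker (mapRingHom (Ideal.Quotient.mk m)) := by
      rw [Polynomial.ker_mapRingHom, Ideal.mk_ker]
    have hker : f - X ^ n * q ∈ m.map C := by
      rw [hmap, RingHom.mem_ker, map_sub, hq]
      simp
    have heq : Ideal.Quotient.mk (kroneckerIdeal m x y n) f =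
        Ideal.Quotient.mk _ (f - X ^ n * q) := by
      rw [Ideal.Quotient.mk_eq_mk_iff_sub_mem, sub_sub_cancel]
      exact Ideal.mul_mem_right _ _ X_pow_mem_kroneckerIdeal
    rw [heq]
    generalize f - X ^ n * q = g at hker
    rw [g.as_sum_support_C_mul_X_pow, map_sum]
    refine Submodule.sum_mem _ fun i _ => ?_
    rw [← smul_mk_eq_mk]
    exact Submodule.smul_mem_smul (Ideal.mem_map_C_iff.1 hker i) Submodule.mem_top

theorem sq_smul_top_eq_bot : m ^ 2 • (⊤ : Submodule R (KroneckerModule m x y n)) = ⊥ := by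
  refine eq_bot_iff.2 (Submodule.smul_le.2 fun r hr v _ => ?_)
  obtain ⟨v, rfl⟩ := Ideal.Quotient.mk_surjective v
  rw [smul_mk_eq_mk, Submodule.mem_bot, Ideal.Quotient.eq_zero_iff_mem]
  exact Ideal.mul_mem_right _ _ (Ideal.mem_sup_right (Ideal.mem_map_of_mem C hr))

/-- Multiplication by `y` is injective from `M / m M` to `m M`, for `M` the Kronecker module. -/
theorem mem_lowCoeffIdeal_of_C_mul_mem (hxy : ∀ a b, a * x + b * y ∈ m ^ 2 → a ∈ m ∧ b ∈ m)
    {f : R[X]} (hf : C y * f ∈ kroneckerIdeal m x y n) : f ∈ lowCoeffIdeal m n := by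
  obtain ⟨_, hg, i, hi, h⟩ := Submodule.mem_sup.1 hf
  obtain ⟨_, ha, _, hc, rfl⟩ := Submodule.mem_sup.1 hg
  obtain ⟨a, rfl⟩ := Ideal.mem_span_singleton.1 ha
  obtain ⟨c, rfl⟩ := Ideal.mem_span_singleton.1 hc
  replace hi := fun d => Ideal.mem_map_C_iff.1 hi d
  have hcoeff : ∀ d < n,
      i.coeff d = y * f.coeff d - (x * c.coeff d + y * (X * c).coeff d) := by
    intro d hd
    have := congrArg (fun p => coeff p d) h
    simp only [coeff_add, add_mul, mul_assoc, coeff_C_mul, coeff_X_pow_mul', if_neg hd.not_ge,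
      zero_add] at this
    linear_combination this
  have hc : ∀ d < n, c.coeff d ∈ m ∧ (f.coeff d - (X * c).coeff d) ∈ m := by
    intro d hd
    have := hxy (-c.coeff d) (f.coeff d - (X * c).coeff d) (by
      convert hi d using 1
      rw [hcoeff d hd]; ring)
    exact ⟨neg_mem_iff.1 this.1, this.2⟩
  refine mem_lowCoeffIdeal.2 fun d hd => ?_
  rcases d with _ | d
  · simpa using (hc 0 hd).2
  · have := add_mem (hc (d + 1) hd).2 (hc d (by omega)).1
    rwa [coeff_X_mul, sub_add_cancel] at this

/-- The ideal of `R[X]` attached to a direct summand `N` of the Kronecker module `M`, namely the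
preimage of `N + m M`. If `M = N ⊕ P`, then it is stable under multiplication by `X`: for `v ∈ N`
the `P`-component `w` of `X v` satisfies `y w = 0`, because `y X v = - x v` lies in `N`, and
hence `w ∈ m M`. -/
noncomputable def summandIdeal (hxy : ∀ a b, a * x + b * y ∈ m ^ 2 → a ∈ m ∧ b ∈ m)
    {N P : Submodule R (KroneckerModule m x y n)} (h : IsCompl N P) : Ideal R[X] where
  carrier := {f | ∃ g ∈ lowCoeffIdeal m n,
    Ideal.Quotient.mk (kroneckerIdeal m x y n) (f - g) ∈ N}
  add_mem' := by
    rintro f f' ⟨g, hg, hfg⟩ ⟨g', hg', hfg'⟩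
    refine ⟨g + g', add_mem hg hg', ?_⟩
    rw [add_sub_add_comm, map_add]
    exact add_mem hfg hfg'
  zero_mem' := ⟨0, zero_mem _, by simp⟩
  smul_mem' := by
    have hC : ∀ (r : R) (f : R[X]), (∃ g ∈ lowCoeffIdeal m n,
        Ideal.Quotient.mk (kroneckerIdeal m x y n) (f - g) ∈ N) → ∃ g ∈ lowCoeffIdeal m n,
        Ideal.Quotient.mk (kroneckerIdeal m x y n) (C r * f - g) ∈ N := by
      rintro r f ⟨g, hg, hfg⟩
      refine ⟨C r * g, Ideal.mul_mem_left _ _ hg, ?_⟩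
      rw [← mul_sub, ← smul_mk_eq_mk]
      exact N.smul_mem r hfg
    have hX : ∀ f : R[X], (∃ g ∈ lowCoeffIdeal m n,
        Ideal.Quotient.mk (kroneckerIdeal m x y n) (f - g) ∈ N) → ∃ g ∈ lowCoeffIdeal m n,
        Ideal.Quotient.mk (kroneckerIdeal m x y n) (X * f - g) ∈ N := by
      rintro f ⟨g, hg, hfg⟩
      obtain ⟨a, ha, b, hb, hab⟩ := Submodule.mem_sup.1 (h.sup_eq_top ▸ Submodule.mem_top :
        Ideal.Quotient.mk (kroneckerIdeal m x y n) (X * (f - g)) ∈ N ⊔ P)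
      obtain ⟨b, rfl⟩ := Ideal.Quotient.mk_surjective b
      have hyb : y • Ideal.Quotient.mk (kroneckerIdeal m x y n) b = 0 := by
        refine Submodule.disjoint_def.1 h.disjoint _ ?_ (P.smul_mem y hb)
        have h0 : y • Ideal.Quotient.mk (kroneckerIdeal m x y n) (X * (f - g)) =
            -(x • Ideal.Quotient.mk (kroneckerIdeal m x y n) (f - g)) := by
          rw [smul_mk_eq_mk, smul_mk_eq_mk, ← map_neg, Ideal.Quotient.mk_eq_mk_iff_sub_mem]
          have : C y * (X * (f - g)) - -(C x * (f - g)) = (C x + C y * X) * (f - g) := by ring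
          rw [this]
          exact Ideal.mul_mem_right _ _ (Ideal.mem_sup_left (Ideal.mem_sup_right
            (Ideal.mem_span_singleton_self _)))
        have h1 : y • Ideal.Quotient.mk (kroneckerIdeal m x y n) b =
            -(x • Ideal.Quotient.mk (kroneckerIdeal m x y n) (f - g)) - y • a := by
          rw [← h0, ← hab, smul_add, add_sub_cancel_left]
        rw [h1]
        exact N.sub_mem (N.neg_mem (N.smul_mem x hfg)) (N.smul_mem y ha)
      rw [smul_mk_eq_mk, Ideal.Quotient.eq_zero_iff_mem] at hyb
      refine ⟨X * g + b, add_mem (Ideal.mul_mem_left _ _ hg)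
        (mem_lowCoeffIdeal_of_C_mul_mem hxy hyb), ?_⟩
      have : X * f - (X * g + b) = X * (f - g) - b := by ring
      rw [this, map_sub, ← hab, add_sub_cancel_right]
      exact ha
    intro p f hf
    rw [smul_eq_mul]
    induction p using Polynomial.induction_on with
    | C a => exact hC a f hf
    | add p q hp hq =>
      obtain ⟨g, hg, hfg⟩ := hp
      obtain ⟨g', hg', hfg'⟩ := hq
      refine ⟨g + g', add_mem hg hg', ?_⟩
      rw [add_mul, add_sub_add_comm, map_add]
      exact add_mem hfg hfg'
    | monomial i a ih =>
      have : C a * X ^ (i + 1) * f = X * (C a * X ^ i * f) := by ring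
      rw [this]
      exact hX _ ih

/-- The summands of a decomposition of the Kronecker module correspond to two ideals of `k[X]`
containing `X ^ n`, where `k = R ⧸ m`. Such ideals are comparable, so one summand is contained
in `m M` and hence zero. -/
theorem isIndecomposable_kroneckerModule (hm : m.IsMaximal) (hx : x ∈ m) (hy : y ∈ m)
    (hxy : ∀ a b, a * x + b * y ∈ m ^ 2 → a ∈ m ∧ b ∈ m) (hn : 0 < n) :
    IsIndecomposable R (KroneckerModule m x y n) := by
  refine ⟨Ideal.Quotient.nontrivial_iff.2 fun htop => ?_, ?_⟩
  · have h1 : (1 : R[X]) ∈ lowCoeffIdeal m n :=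
      kroneckerIdeal_le_lowCoeffIdeal hx hy (htop ▸ Submodule.mem_top)
    exact (Ideal.ne_top_iff_one m).1 hm.ne_top (by simpa using mem_lowCoeffIdeal.1 h1 0 hn)
  have key : ∀ N P : Submodule R (KroneckerModule m x y n), ∀ h : IsCompl N P,
      summandIdeal hxy h ≤ summandIdeal hxy h.symm → N = ⊥ := by
    intro N P h hle
    have hN : N ≤ m • N := by
      intro v hv
      obtain ⟨f, rfl⟩ := Ideal.Quotient.mk_surjective v
      obtain ⟨g, hg, hfg⟩ := hle ⟨0, zero_mem _, by rwa [sub_zero]⟩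
      refine mem_smul_of_isCompl h m hv (P.neg_mem hfg) ?_
      rw [← map_neg, ← map_add, mk_mem_smul_top_iff hx hy]
      convert hg using 1
      ring
    rw [eq_bot_iff]
    calc N ≤ m • N := hN
      _ ≤ m • m • ⊤ := Submodule.smul_mono le_rfl (hN.trans (Submodule.smul_mono le_rfl le_top))
      _ = ⊥ := by rw [← Submodule.mul_smul, ← pow_two, sq_smul_top_eq_bot]
  intro N P h
  let _ := Ideal.Quotient.field m
  let φ := mapRingHom (Ideal.Quotient.mk m)
  have hφ : Function.Surjective φ := map_surjective _ Ideal.Quotient.mk_surjective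
  have hlow : ∀ {N P : Submodule R (KroneckerModule m x y n)} (h : IsCompl N P),
      lowCoeffIdeal m n ≤ summandIdeal hxy h := fun h f hf => ⟨f, hf, by simp⟩
  have hX : ∀ {N P : Submodule R (KroneckerModule m x y n)} (h : IsCompl N P),
      X ^ n ∈ (summandIdeal hxy h).map φ := fun h => by
    have := Ideal.mem_map_of_mem φ (hlow h
      (kroneckerIdeal_le_lowCoeffIdeal hx hy X_pow_mem_kroneckerIdeal))
    simpa [φ] using this
  have hcomap : ∀ {N P : Submodule R (KroneckerModule m x y n)} (h : IsCompl N P),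
      ((summandIdeal hxy h).map φ).comap φ = summandIdeal hxy h := fun h => by
    rw [Ideal.comap_map_of_surjective φ hφ, sup_eq_left]
    exact (Ideal.comap_mono bot_le).trans (hlow h)
  refine (le_total_of_X_pow_mem (hX h) (hX h.symm)).imp (fun hle => key N P h ?_)
    (fun hle => key P N h.symm ?_)
  · rw [← hcomap h, ← hcomap h.symm]; exact Ideal.comap_mono hle
  · rw [← hcomap h, ← hcomap h.symm]; exact Ideal.comap_mono hle

theorem finite_kroneckerModule : Module.Finite R (KroneckerModule m x y n) := by
  have := (monic_X_pow (R := R) n).finite_quotient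
  exact Module.Finite.of_surjective
    (Ideal.Quotient.factorₐ R (le_sup_left.trans le_sup_left :
      Ideal.span {X ^ n} ≤ kroneckerIdeal m x y n)).toLinearMap
    (Ideal.Quotient.factor_surjective (le_sup_left.trans le_sup_left))

/-- For `p < q` the module of index `p` is a proper quotient of that of index `q`, so the two cannot
be isomorphic, as a surjective endomorphism of a noetherian module is injective. -/
theorem kroneckerModule_eq_of_linearEquiv [IsNoetherianRing R] (hm : m ≠ ⊤) (hx : x ∈ m)
    (hy : y ∈ m) {p q : ℕ} (e : KroneckerModule m x y p ≃ₗ[R] KroneckerModule m x y q) :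
    p = q := by
  have key : ∀ p q, p < q → (KroneckerModule m x y p ≃ₗ[R] KroneckerModule m x y q) → False := by
    intro p q hpq e
    have := finite_kroneckerModule (m := m) (x := x) (y := y) (n := q)
    have hle : kroneckerIdeal m x y q ≤ kroneckerIdeal m x y p :=
      sup_le_sup_right (sup_le_sup_right (Ideal.span_singleton_le_span_singleton.2
        (pow_dvd_pow X hpq.le)) _) _
    let g := (Ideal.Quotient.factorₐ R hle).toLinearMap
    have hg : Function.Surjective g := Ideal.Quotient.factor_surjective hle
    have hinj := IsNoetherian.injective_of_surjective_endomorphism (e.toLinearMap ∘ₗ g)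
      (e.surjective.comp hg)
    have h0 : Ideal.Quotient.mk (kroneckerIdeal m x y q) (X ^ p) = 0 := by
      refine hinj ?_
      rw [map_zero, LinearMap.comp_apply]
      have : g (Ideal.Quotient.mk (kroneckerIdeal m x y q) (X ^ p)) =
        Ideal.Quotient.mk (kroneckerIdeal m x y p) (X ^ p) := rfl
      rw [this, Ideal.Quotient.eq_zero_iff_mem.2 X_pow_mem_kroneckerIdeal, map_zero]
    have h1 := mem_lowCoeffIdeal.1 (kroneckerIdeal_le_lowCoeffIdeal hx hy
      (Ideal.Quotient.eq_zero_iff_mem.1 h0)) p hpq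
    exact (Ideal.ne_top_iff_one m).1 hm (by simpa using h1)
  rcases lt_trichotomy p q with h | h | h
  · exact (key p q h e).elim
  · exact h
  · exact (key q p h e.symm).elim

theorem isPrincipalIdealRing_of_hasFiniteRepresentationType (R : Type u) [CommRing R]
    [IsArtinianRing R] (h : HasFiniteRepresentationType R) : IsPrincipalIdealRing R := by
  by_contra hR
  obtain ⟨m, hm, x, hx, y, hy, hxy⟩ := exists_independent_pair hR
  obtain ⟨n, L, hL⟩ := h
  choose i hi using fun p : ℕ => hL (KroneckerModule m x y (p + 1)) finite_kroneckerModule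
    (isIndecomposable_kroneckerModule hm hx hy hxy p.succ_pos)
  obtain ⟨p, q, hpq, hi'⟩ := Finite.exists_ne_map_eq_of_infinite i
  obtain ⟨e⟩ := hi p
  obtain ⟨e'⟩ := hi q
  rw [← hi'] at e'
  exact hpq (Nat.succ_injective (kroneckerModule_eq_of_linearEquiv hm.ne_top hx hy
    (e.trans e'.symm)))

end KroneckerModule

end CompFactors

theorem theorem2p10 (R : Type u) [CommRing R] [IsArtinianRing R] :
    List.TFAE [
      CompFactors.IsSerialRing R,
      IsPrincipalIdealRing R,
      ∀ I : Ideal R, I ≠ ⊤ → CompFactors.IsSelfInjective (R ⧸ I),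
      CompFactors.HasFiniteRepresentationType R,
      CompFactors.DeterminedByCompositionFactors R] := by
  tfae_have 1 → 2 := CompFactors.IsSerialRing.isPrincipalIdealRing
  tfae_have 2 → 1 := fun _ => CompFactors.isSerialRing_of_isPrincipalIdealRing R
  tfae_have 2 → 3 := fun _ I _ => by
    have := IsPrincipalIdealRing.of_surjective (Ideal.Quotient.mk I) Ideal.Quotient.mk_surjective
    exact CompFactors.isSelfInjective_of_isPrincipalIdealRing _
  tfae_have 3 → 2 := CompFactors.isPrincipalIdealRing_of_isSelfInjective_quotient R
  tfae_have 2 → 4 := fun _ => CompFactors.hasFiniteRepresentationType_of_isPrincipalIdealRing R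
  tfae_have 4 → 2 := CompFactors.isPrincipalIdealRing_of_hasFiniteRepresentationType R
  tfae_have 2 → 5 := fun _ =>
    CompFactors.determinedByCompositionFactors_of_isPrincipalIdealRing R
  tfae_have 5 → 2 := CompFactors.isPrincipalIdealRing_of_determinedByCompositionFactors R
  tfae_finish
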